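/- Let $n_1,n_2,m,s\ge 0$ be integers, $K=\min\{n_1,n_2\}$, and let $\mathcal A:\mathbb R^{n_1\times n_2}\to\mathbb R^m$ be a linear map with null space $\mathcal N(\mathcal A)$. For $Z\in\mathbb R^{n_1\times n_2}$ let $\sigma_1(Z)\ge\sigma_2(Z)\ge\dots\ge\sigma_K(Z)\ge 0$ be its singular values, put $\sigma_i(Z)=0$ for $i>K$, and let $\|Z\|_*=\sum_{i=1}^K\sigma_i(Z)$ be its nuclear norm. Nuclear norm minimization is said to recover $Z_0\in\mathbb R^{n_1\times n_2}$ if, with $y=\mathcal A Z_0$, the matrix $Z_0$ is the unique solution of $$\min_{Z\in\mathbb R^{n_1\times n_2}}\|Z\|_*\quad\text{subject to}\quad \mathcal A Z=y.$$ Then nuclear norm minimization recovers every matrix $Z_0\in\mathbb R^{n_1\times n_2}$ of rank at most $s$ if and only if $$\sum_{i=1}^{s}\sigma_i(Z)<\sum_{i=s+1}^{K}\sigma_i(Z)\qquad\text{for every } Z\in\mathcal N(\mathcal A)\setminus\{0\}.$$ -/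

import Mathlib

noncomputable section

namespace NuclearRecovery

/-- The singular values of a real `n₁ × n₂` matrix in decreasing order, with multiplicity.
The index starts at `0`, so `σ_i(Z)` of the usual notation is `singularValue Z (i - 1)`;
the values with index at least `min n₁ n₂` are `0`. -/
def singularValue {n₁ n₂ : ℕ} (Z : Matrix (Fin n₁) (Fin n₂) ℝ) (i : ℕ) : ℝ :=
  (Matrix.toEuclideanLin Z).singularValues i

/-- The nuclear norm, the sum of the `min n₁ n₂` singular values. -/
def nuclearNorm {n₁ n₂ : ℕ} (Z : Matrix (Fin n₁) (Fin n₂) ℝ) : ℝ :=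
  ∑ i ∈ Finset.range (min n₁ n₂), singularValue Z i

/-- The set of matrices of rank at most `s`. -/
def lowRank (n₁ n₂ s : ℕ) : Set (Matrix (Fin n₁) (Fin n₂) ℝ) :=
  {Z | Z.rank ≤ s}

/-- The set of solutions of the problem: minimize `‖Z‖_*` subject to `A Z = y`. -/
def nuclearMinimizers {n₁ n₂ m : ℕ}
    (A : Matrix (Fin n₁) (Fin n₂) ℝ →ₗ[ℝ] EuclideanSpace ℝ (Fin m))
    (y : EuclideanSpace ℝ (Fin m)) : Set (Matrix (Fin n₁) (Fin n₂) ℝ) :=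
  {Z | A Z = y ∧ ∀ X : Matrix (Fin n₁) (Fin n₂) ℝ, A X = y → nuclearNorm Z ≤ nuclearNorm X}

/-- Nuclear norm minimization is successful at recovering all matrices in `S`: each `Z₀ ∈ S` is
the one and only solution of the problem with the data `y = A Z₀`. -/
def RecoversAll {n₁ n₂ m : ℕ}
    (A : Matrix (Fin n₁) (Fin n₂) ℝ →ₗ[ℝ] EuclideanSpace ℝ (Fin m))
    (S : Set (Matrix (Fin n₁) (Fin n₂) ℝ)) : Prop :=
  ∀ Z₀ ∈ S, nuclearMinimizers A (A Z₀) = {Z₀}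

end NuclearRecovery

end

/-! Sufficiency rests on Mirsky's inequality `∑ |σ_i(X) - σ_i(Z)| ≤ ‖X - Z‖_*`. If `X` has rank at
most `s`, its singular values vanish from the `(s+1)`-st on, so the left side is at least `‖X‖_* -
∑_{i≤s} σ_i(Z) + ∑_{i>s} σ_i(Z)`, which exceeds `‖X‖_*` for nonzero `Z` in the kernel. Every other
feasible point is such an `X - Z`.

Necessity: cut the SVD of a kernel element after `s` terms, `Z = X - Y`. Then `A X = A Y`, and if
the inequality fails for `Z`, then `‖Y‖_* ≤ ‖X‖_*`, so `Y ≠ X` is a second minimizer.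

Mirsky's inequality is proved by one symmetric operator `D` on `F × E` that dominates the dilations
`[0, S; S†, 0]` and `[0, T; T†, 0]` and has trace `‖S - T‖_*`. A dilation has eigenvalues `±σ_i` and
zeros, so the `i`-th eigenvalues of `D` from the top and from the bottom add up to at least
`max(σ_i(S), σ_i(T)) - min(σ_i(S), σ_i(T))`. -/

namespace NuclearRecovery

open Module

section InnerProductSpace

variable {E F H : Type*} [NormedAddCommGroup E] [InnerProductSpace ℝ E]
  [NormedAddCommGroup F] [InnerProductSpace ℝ F] [NormedAddCommGroup H] [InnerProductSpace ℝ H]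

/-! ### Singular value decomposition and trace duality -/

theorem sum_inner_sq_le {ι : Type*} [Fintype ι] {v : ι → E} (hv : Orthonormal ℝ v) (x : E) :
    ∑ i, inner ℝ (v i) x ^ 2 ≤ ‖x‖ ^ 2 := by
  simpa using hv.sum_inner_products_le x (s := Finset.univ)

/-- Each rank-one term contributes at most `c k`, by AM-GM and Bessel's inequality. -/
theorem sum_inner_apply_le_of_eq_sum {ι κ : Type*} [Fintype ι] [Fintype κ] {T : E →ₗ[ℝ] F}
    {c : κ → ℝ} {b : κ → E} {a : κ → F} (hc : ∀ k, 0 ≤ c k) (hb : ∀ k, ‖b k‖ = 1)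
    (ha : ∀ k, ‖a k‖ = 1) (hT : ∀ x, T x = ∑ k, (c k * inner ℝ (b k) x) • a k)
    {q : ι → E} {p : ι → F} (hq : Orthonormal ℝ q) (hp : Orthonormal ℝ p) :
    ∑ i, inner ℝ (p i) (T (q i)) ≤ ∑ k, c k := by
  simp_rw [hT, inner_sum, inner_smul_right]
  rw [Finset.sum_comm]
  refine Finset.sum_le_sum fun k _ => ?_
  have h1 := sum_inner_sq_le hq (b k)
  have h2 := sum_inner_sq_le hp (a k)
  rw [hb] at h1
  rw [ha] at h2
  calc ∑ i, c k * inner ℝ (b k) (q i) * inner ℝ (p i) (a k)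
      ≤ ∑ i, c k * ((inner ℝ (q i) (b k) ^ 2 + inner ℝ (p i) (a k) ^ 2) / 2) := by
        refine Finset.sum_le_sum fun i _ => ?_
        rw [mul_assoc, real_inner_comm]
        refine mul_le_mul_of_nonneg_left ?_ (hc k)
        linarith [two_mul_le_add_sq (inner ℝ (q i) (b k)) (inner ℝ (p i) (a k))]
    _ = c k * ((∑ i, inner ℝ (q i) (b k) ^ 2 + ∑ i, inner ℝ (p i) (a k) ^ 2) / 2) := by
        rw [← Finset.mul_sum, ← Finset.sum_div, Finset.sum_add_distrib]
    _ ≤ c k * 1 := mul_le_mul_of_nonneg_left (by linarith) (hc k)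
    _ = c k := mul_one _

theorem inner_apply_of_eq_sum {κ : Type*} [Fintype κ] {T : E →ₗ[ℝ] F}
    {c : κ → ℝ} {b : κ → E} {a : κ → F} (hb : Orthonormal ℝ b) (ha : Orthonormal ℝ a)
    (hT : ∀ x, T x = ∑ k, (c k * inner ℝ (b k) x) • a k) (j : κ) :
    inner ℝ (a j) (T (b j)) = c j := by
  classical
  simp [hT, inner_smul_right, orthonormal_iff_ite.1 hb, ha.1 j]

variable [FiniteDimensional ℝ E] [FiniteDimensional ℝ F] [FiniteDimensional ℝ H]

/-- The compact form of the singular value decomposition. -/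
theorem exists_svd (T : E →ₗ[ℝ] F) :
    ∃ (v : Fin (finrank ℝ T.range) → E) (u : Fin (finrank ℝ T.range) → F),
      Orthonormal ℝ v ∧ Orthonormal ℝ u ∧
      ∀ x, T x = ∑ i : Fin (finrank ℝ T.range), (T.singularValues i * inner ℝ (v i) x) • u i := by
  have hr : finrank ℝ T.range ≤ finrank ℝ E := T.finrank_range_le
  set e := T.isSymmetric_adjoint_comp_self.eigenvectorBasis rfl with he
  have hinner : ∀ i j, inner ℝ (T (e i)) (T (e j)) =
      if i = j then T.singularValues i ^ 2 else 0 := by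
    intro i j
    rw [← LinearMap.adjoint_inner_right, ← LinearMap.comp_apply, he,
      T.isSymmetric_adjoint_comp_self.apply_eigenvectorBasis rfl, ← he, inner_smul_right,
      orthonormal_iff_ite.1 e.orthonormal]
    split_ifs with h
    · subst h
      simp [T.sq_singularValues_fin rfl]
    · simp
  have hpos : ∀ i : Fin (finrank ℝ T.range), 0 < T.singularValues i := fun i =>
    T.singularValues_pos_iff_lt_finrank_range.2 i.2
  -- The right vectors are eigenvectors of `T†T`, the left ones their normalized images; the indices
  -- stop at the rank, so the divisors are positive.
  refine ⟨fun i => e (Fin.castLE hr i),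
    fun i => (T.singularValues i)⁻¹ • T (e (Fin.castLE hr i)),
    e.orthonormal.comp _ (Fin.castLE_injective hr), ?_, fun x => ?_⟩
  · rw [orthonormal_iff_ite]
    intro i j
    rw [inner_smul_left, inner_smul_right, hinner]
    have := (hpos i).ne'
    by_cases h : i = j
    · subst h
      simp
      field_simp
    · simp [h]
  · conv_lhs => rw [← e.sum_repr' x, map_sum]
    symm
    refine Fintype.sum_of_injective (Fin.castLE hr) (Fin.castLE_injective hr) _ _ ?_ ?_
    · intro j hj
      have hj' : finrank ℝ T.range ≤ j := by
        by_contra! h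
        exact hj ⟨⟨j, h⟩, rfl⟩
      have h0 : T (e j) = 0 := by
        have h := hinner j j
        rw [if_pos rfl, T.singularValues_eq_zero_iff_le_finrank_range.2 hj'] at h
        simpa using h
      simp [h0]
    · intro i
      have := (hpos i).ne'
      rw [smul_smul, map_smul]
      congr 1
      field_simp

theorem sum_range_singularValues (T : E →ₗ[ℝ] F) {k : ℕ} (hk : finrank ℝ T.range ≤ k) :
    ∑ i ∈ Finset.range k, T.singularValues i =
      ∑ i : Fin (finrank ℝ T.range), T.singularValues i := by
  rw [← Finset.sum_range (fun i => T.singularValues i)]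
  symm
  refine Finset.sum_subset (Finset.range_mono hk) fun i _ hi => ?_
  exact T.singularValues_eq_zero_iff_le_finrank_range.2 (by simpa using hi)

/-- The duality bound, applied both ways between this decomposition and the one of `exists_svd`,
equates the two sums without matching individual coefficients. -/
theorem sum_range_singularValues_eq_of_eq_sum {κ : Type*} [Fintype κ] {T : E →ₗ[ℝ] F}
    {c : κ → ℝ} {b : κ → E} {a : κ → F} (hc : ∀ k, 0 ≤ c k) (hb : Orthonormal ℝ b)
    (ha : Orthonormal ℝ a) (hT : ∀ x, T x = ∑ k, (c k * inner ℝ (b k) x) • a k)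
    {k : ℕ} (hk : finrank ℝ T.range ≤ k) :
    ∑ i ∈ Finset.range k, T.singularValues i = ∑ k, c k := by
  rw [sum_range_singularValues T hk]
  obtain ⟨v, u, hv, hu, hvu⟩ := exists_svd T
  apply le_antisymm
  · simpa [inner_apply_of_eq_sum hv hu hvu] using
      sum_inner_apply_le_of_eq_sum hc hb.1 ha.1 hT hv hu
  · simpa [inner_apply_of_eq_sum hb ha hT] using
      sum_inner_apply_le_of_eq_sum (c := fun i : Fin (finrank ℝ T.range) => T.singularValues i)
        (fun i => T.singularValues_nonneg i) hv.1 hu.1 hvu hb ha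

/-! ### Courant–Fischer and test subspaces for the dilation -/

/-- The lower half of the Courant–Fischer principle for the ordered eigenvalues of a symmetric
operator. -/
theorem exists_eigenvalue_sequence {D : H →ₗ[ℝ] H} (hD : D.IsSymmetric) :
    ∃ lam : ℕ → ℝ, ∑ i ∈ Finset.range (finrank ℝ H), lam i = LinearMap.trace ℝ H D ∧
      ∀ i < finrank ℝ H, ∀ (c : ℝ) (S : Submodule ℝ H), i < finrank ℝ S →
        (∀ x ∈ S, c * ‖x‖ ^ 2 ≤ inner ℝ x (D x)) → c ≤ lam i := by
  set e := hD.eigenvectorBasis rfl with he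
  -- Padding by `0` makes the sequence total on `ℕ`, so that indices can be reflected and shifted
  -- freely.
  refine ⟨fun i => if h : i < finrank ℝ H then hD.eigenvalues rfl ⟨i, h⟩ else 0, ?_, ?_⟩
  · rw [hD.trace_eq_sum_eigenvalues rfl, Finset.sum_range]
    simp
  · intro i hi c S hS hc
    -- As `dim S > i`, some nonzero `x ∈ S` is orthogonal to the top `i` eigenvectors; on it the
    -- form is at most `lam i * ‖x‖ ^ 2`.
    let φ : S →ₗ[ℝ] (Fin i → ℝ) :=
      LinearMap.pi fun j => (innerₛₗ ℝ (e (Fin.castLE hi.le j))).comp S.subtype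
    obtain ⟨x, hx, hx0⟩ := Submodule.exists_mem_ne_zero_of_ne_bot
      (LinearMap.ker_ne_bot_of_finrank_lt (f := φ) (by simpa using hS))
    have hzero : ∀ j : Fin (finrank ℝ H), (j : ℕ) < i → inner ℝ (e j) (x : H) = 0 :=
      fun j hj => congrFun (LinearMap.mem_ker.1 hx) ⟨j, hj⟩
    have hform : inner ℝ (x : H) (D x) =
        ∑ j, hD.eigenvalues rfl j * inner ℝ (e j) (x : H) ^ 2 := by
      rw [← e.sum_inner_mul_inner]
      refine Finset.sum_congr rfl fun j _ => ?_
      rw [← hD, he, hD.apply_eigenvectorBasis, ← he, inner_smul_left, real_inner_comm]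
      simp
      ring
    have hle := hc x x.2
    rw [hform] at hle
    simp only [dif_pos hi]
    have hpos : 0 < ‖(x : H)‖ ^ 2 := by
      have : (x : H) ≠ 0 := by simpa using hx0
      positivity
    refine le_of_mul_le_mul_right ?_ hpos
    refine hle.trans ?_
    rw [← e.sum_sq_norm_inner_right, Finset.mul_sum]
    refine (Finset.sum_le_sum fun j _ => ?_)
    rw [Real.norm_eq_abs, sq_abs]
    by_cases hj : (j : ℕ) < i
    · simp [hzero j hj]
    · exact mul_le_mul_of_nonneg_right (hD.eigenvalues_antitone rfl (by
        simpa [Fin.le_def] using hj)) (sq_nonneg _)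

theorem card_subtype_fin_lt_le (n i : ℕ) : Fintype.card {j : Fin n // (j : ℕ) < i} ≤ i := by
  simpa using Fintype.card_le_of_injective
    (fun j : {j : Fin n // (j : ℕ) < i} => (⟨j.1, j.2⟩ : Fin i))
    (fun a b h => by simpa [Subtype.ext_iff, Fin.ext_iff] using h)

theorem finrank_withLp_prod : finrank ℝ (WithLp 2 (F × E)) = finrank ℝ F + finrank ℝ E := by
  rw [(WithLp.linearEquiv 2 ℝ (F × E)).finrank_eq, finrank_prod]

/-- `2⟨x.fst, T x.snd⟩` is the quadratic form of the dilation of `T`. The span of the pairs `(u_j,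
v_j)`, `j ≤ i`, serves as test space. -/
theorem exists_submodule_singularValues_le (T : E →ₗ[ℝ] F) {i : ℕ}
    (hF : i < finrank ℝ F) :
    ∃ S : Submodule ℝ (WithLp 2 (F × E)), i < finrank ℝ S ∧
      ∀ x ∈ S, T.singularValues i * ‖x‖ ^ 2 ≤ 2 * inner ℝ x.fst (T x.snd) := by
  rcases (T.singularValues_nonneg i).eq_or_lt with h0 | hpos
  -- The compact SVD has no vectors for `σ_i = 0`; here the form vanishes on `F × 0`.
  · refine ⟨LinearMap.ker (WithLp.sndₗ 2 ℝ F E), ?_, fun x hx => ?_⟩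
    · have h1 := (WithLp.sndₗ 2 ℝ F E).finrank_range_add_finrank_ker
      have h2 := (LinearMap.range (WithLp.sndₗ 2 ℝ F E)).finrank_le
      rw [finrank_withLp_prod] at h1
      omega
    · have : x.snd = 0 := hx
      simp [← h0, this]
  · obtain ⟨v, u, hv, hu, hT⟩ := exists_svd T
    have hr := T.singularValues_pos_iff_lt_finrank_range.1 hpos
    let f : Fin (i + 1) → Fin (finrank ℝ T.range) := Fin.castLE hr
    have hf : Function.Injective f := Fin.castLE_injective hr
    have hv' := hv.comp f hf
    have hu' := hu.comp f hf
    let w : Fin (i + 1) → WithLp 2 (F × E) := fun j => WithLp.toLp 2 (u (f j), v (f j))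
    have hw : LinearIndependent ℝ w :=
      LinearIndependent.of_comp (WithLp.fstₗ 2 ℝ F E) hu'.linearIndependent
    refine ⟨Submodule.span ℝ (Set.range w), ?_, fun x hx => ?_⟩
    · rw [finrank_span_eq_card hw]
      simp
    · obtain ⟨c, rfl⟩ := (Submodule.mem_span_range_iff_exists_fun ℝ).1 hx
      have hfst : (∑ j, c j • w j).fst = ∑ j, c j • u (f j) := by
        change WithLp.fstₗ 2 ℝ F E _ = _
        simp only [map_sum, map_smul]
        rfl
      have hsnd : (∑ j, c j • w j).snd = ∑ j, c j • v (f j) := by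
        change WithLp.sndₗ 2 ℝ F E _ = _
        simp only [map_sum, map_smul]
        rfl
      have hTv : ∀ j, T (v j) = T.singularValues j • u j := by
        intro j
        simp [hT, orthonormal_iff_ite.1 hv]
      have hTsum : T (∑ j, c j • v (f j)) = ∑ j, (c j * T.singularValues j) • u (f j) := by
        simp [map_sum, hTv, smul_smul, f]
      rw [WithLp.prod_norm_sq_eq_of_L2, hfst, hsnd, hTsum, ← real_inner_self_eq_norm_sq,
        ← real_inner_self_eq_norm_sq]
      have h1 := hu'.inner_sum c c Finset.univ
      have h2 := hv'.inner_sum c c Finset.univ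
      have h3 := hu'.inner_sum c (fun j => c j * T.singularValues j) Finset.univ
      simp only [Function.comp_apply, conj_trivial] at h1 h2 h3
      rw [h1, h2, h3, ← two_mul, mul_left_comm, Finset.mul_sum]
      refine mul_le_mul_of_nonneg_left (Finset.sum_le_sum fun j _ => ?_) zero_le_two
      have := T.singularValues_antitone (Nat.lt_succ_iff.1 j.2)
      nlinarith [mul_self_nonneg (c j)]

/-- Requiring `x.snd ⊥ v_j` for `j < i` costs at most `i` dimensions and leaves only terms with `σ_j
≤ σ_i`, bounded by AM-GM and Bessel. -/
theorem exists_submodule_neg_singularValues_le (T : E →ₗ[ℝ] F) (i : ℕ) :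
    ∃ S : Submodule ℝ (WithLp 2 (F × E)), finrank ℝ F + finrank ℝ E ≤ finrank ℝ S + i ∧
      ∀ x ∈ S, -T.singularValues i * ‖x‖ ^ 2 ≤ 2 * inner ℝ x.fst (T x.snd) := by
  obtain ⟨v, u, hv, hu, hT⟩ := exists_svd T
  let φ : WithLp 2 (F × E) →ₗ[ℝ] ({j : Fin (finrank ℝ T.range) // (j : ℕ) < i} → ℝ) :=
    LinearMap.pi fun j => (innerₛₗ ℝ (v j)).comp (WithLp.sndₗ 2 ℝ F E)
  refine ⟨LinearMap.ker φ, ?_, fun x hx => ?_⟩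
  · have h1 := φ.finrank_range_add_finrank_ker
    have h2 := (LinearMap.range φ).finrank_le
    have h3 := card_subtype_fin_lt_le (finrank ℝ T.range) i
    rw [finrank_withLp_prod] at h1
    rw [finrank_fintype_fun_eq_card] at h2
    omega
  · have hx0 : ∀ j : Fin (finrank ℝ T.range), (j : ℕ) < i → inner ℝ (v j) x.snd = 0 :=
      fun j hj => congrFun (LinearMap.mem_ker.1 hx) ⟨j, hj⟩
    have h1 := sum_inner_sq_le hv x.snd
    have h2 := sum_inner_sq_le hu x.fst
    have hσ := T.singularValues_nonneg i
    have hterm : -T.singularValues i * (∑ j, inner ℝ (v j) x.snd ^ 2 +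
        ∑ j, inner ℝ (u j) x.fst ^ 2) ≤ 2 * inner ℝ x.fst (T x.snd) := by
      rw [hT, inner_sum, ← Finset.sum_add_distrib, Finset.mul_sum, Finset.mul_sum]
      refine Finset.sum_le_sum fun j _ => ?_
      rw [inner_smul_right, real_inner_comm (u j) x.fst]
      by_cases hj : (j : ℕ) < i
      · rw [hx0 j hj]
        nlinarith [mul_nonneg hσ (sq_nonneg (inner ℝ (u j) x.fst))]
      · have ha := T.singularValues_antitone (not_lt.1 hj)
        have hn := T.singularValues_nonneg j
        set p := inner ℝ (v j) x.snd
        set q := inner ℝ (u j) x.fst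
        nlinarith [mul_nonneg hn (sq_nonneg (p + q)),
          mul_nonneg (sub_nonneg.2 ha) (add_nonneg (sq_nonneg p) (sq_nonneg q))]
    rw [WithLp.prod_norm_sq_eq_of_L2]
    nlinarith [mul_nonneg hσ (sub_nonneg.2 h1), mul_nonneg hσ (sub_nonneg.2 h2)]

/-! ### Mirsky's inequality -/

/-- The operator with block matrix `[P, M; M†, Q]`. -/
noncomputable def blockOperator (P : F →ₗ[ℝ] F) (Q : E →ₗ[ℝ] E) (M : E →ₗ[ℝ] F) :
    WithLp 2 (F × E) →ₗ[ℝ] WithLp 2 (F × E) where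
  toFun x := WithLp.toLp 2 (P x.fst + M x.snd, LinearMap.adjoint M x.fst + Q x.snd)
  map_add' x y := by
    simp only [WithLp.add_fst, WithLp.add_snd, map_add, ← WithLp.toLp_add, Prod.mk_add_mk]
    congr 2 <;> abel
  map_smul' c x := by
    simp [WithLp.smul_fst, WithLp.smul_snd, map_smul, ← WithLp.toLp_smul]

theorem inner_blockOperator (P : F →ₗ[ℝ] F) (Q : E →ₗ[ℝ] E) (M : E →ₗ[ℝ] F)
    (x : WithLp 2 (F × E)) :
    inner ℝ x (blockOperator P Q M x) =
      inner ℝ x.fst (P x.fst) + inner ℝ x.snd (Q x.snd) + 2 * inner ℝ x.fst (M x.snd) := by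
  change inner ℝ x.fst (P x.fst + M x.snd) +
    inner ℝ x.snd (LinearMap.adjoint M x.fst + Q x.snd) = _
  rw [inner_add_right, inner_add_right, LinearMap.adjoint_inner_right,
    real_inner_comm x.fst (M x.snd)]
  ring

theorem blockOperator_isSymmetric {P : F →ₗ[ℝ] F} {Q : E →ₗ[ℝ] E} (hP : P.IsSymmetric)
    (hQ : Q.IsSymmetric) (M : E →ₗ[ℝ] F) : (blockOperator P Q M).IsSymmetric := by
  intro x y
  change inner ℝ (P x.fst + M x.snd) y.fst +
      inner ℝ (LinearMap.adjoint M x.fst + Q x.snd) y.snd =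
    inner ℝ x.fst (P y.fst + M y.snd) + inner ℝ x.snd (LinearMap.adjoint M y.fst + Q y.snd)
  simp only [inner_add_left, inner_add_right, LinearMap.adjoint_inner_right,
    LinearMap.adjoint_inner_left, hP x.fst y.fst, hQ x.snd y.snd]
  ring

theorem trace_blockOperator (P : F →ₗ[ℝ] F) (Q : E →ₗ[ℝ] E) (M : E →ₗ[ℝ] F) :
    LinearMap.trace ℝ _ (blockOperator P Q M) =
      LinearMap.trace ℝ F P + LinearMap.trace ℝ E Q := by
  rw [LinearMap.trace_eq_sum_inner _
      ((stdOrthonormalBasis ℝ F).prod (stdOrthonormalBasis ℝ E)), Fintype.sum_sum_type,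
    LinearMap.trace_eq_sum_inner P (stdOrthonormalBasis ℝ F),
    LinearMap.trace_eq_sum_inner Q (stdOrthonormalBasis ℝ E)]
  congr 1 <;> refine Finset.sum_congr rfl fun i _ => ?_ <;> rw [inner_blockOperator] <;>
    simp [WithLp.fst, WithLp.snd]

/-- Mirsky's inequality for the nuclear norm. -/
theorem sum_abs_singularValues_sub_le (S T : E →ₗ[ℝ] F) :
    ∑ i ∈ Finset.range (min (finrank ℝ F) (finrank ℝ E)),
        |S.singularValues i - T.singularValues i| ≤
      ∑ i ∈ Finset.range (min (finrank ℝ F) (finrank ℝ E)), (S - T).singularValues i := by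
  obtain ⟨v, u, hv, hu, hX⟩ := exists_svd (S - T)
  have hσ0 : ∀ j : Fin (finrank ℝ (S - T).range), 0 ≤ (S - T).singularValues j :=
    fun j => (S - T).singularValues_nonneg j
  obtain ⟨σ, hσ⟩ : ∃ σ : Fin (finrank ℝ (S - T).range) → ℝ,
      ∀ j : Fin _, (S - T).singularValues j = σ j := ⟨_, fun _ => rfl⟩
  simp_rw [hσ] at hX hσ0
  -- With these diagonal blocks, `D` minus the dilation of `S` or `T` has the form `∑ σ_j / 2 *
  -- (⟨u_j, x.fst⟩ ∓ ⟨v_j, x.snd⟩) ^ 2`, with `-` for `S` and `+` for `T`.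
  let P : F →ₗ[ℝ] F := ∑ j, (σ j / 2) • (InnerProductSpace.rankOne ℝ (u j) (u j)).toLinearMap
  let Q : E →ₗ[ℝ] E := ∑ j, (σ j / 2) • (InnerProductSpace.rankOne ℝ (v j) (v j)).toLinearMap
  have hPapp : ∀ a, P a = ∑ j, (σ j / 2) • inner ℝ (u j) a • u j := fun a => by simp [P]
  have hQapp : ∀ b, Q b = ∑ j, (σ j / 2) • inner ℝ (v j) b • v j := fun a => by simp [Q]
  have hP : P.IsSymmetric := fun x y => by
    simp only [hPapp, sum_inner, inner_sum, inner_smul_left, inner_smul_right, conj_trivial]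
    refine Finset.sum_congr rfl fun j _ => ?_
    rw [real_inner_comm (u j) x]
    ring
  have hQ : Q.IsSymmetric := fun x y => by
    simp only [hQapp, sum_inner, inner_sum, inner_smul_left, inner_smul_right, conj_trivial]
    refine Finset.sum_congr rfl fun j _ => ?_
    rw [real_inner_comm (v j) x]
    ring
  have htrP : LinearMap.trace ℝ F P = ∑ j, σ j / 2 := by
    simp [P, InnerProductSpace.trace_rankOne, hu.1]
  have htrQ : LinearMap.trace ℝ E Q = ∑ j, σ j / 2 := by
    simp [Q, InnerProductSpace.trace_rankOne, hv.1]
  set D := blockOperator P Q ((1 / 2 : ℝ) • (S + T)) with hDdef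
  have hform : ∀ x, inner ℝ x (D x) = ∑ j, σ j / 2 * (inner ℝ (u j) x.fst ^ 2 +
      inner ℝ (v j) x.snd ^ 2) + (inner ℝ x.fst (S x.snd) + inner ℝ x.fst (T x.snd)) := by
    intro x
    rw [hDdef, inner_blockOperator, hPapp, hQapp, inner_sum, inner_sum,
      ← Finset.sum_add_distrib]
    congr 1
    · refine Finset.sum_congr rfl fun j _ => ?_
      simp only [inner_smul_right]
      rw [real_inner_comm (u j) x.fst, real_inner_comm (v j) x.snd]
      ring
    · simp only [LinearMap.smul_apply, LinearMap.add_apply, inner_smul_right, inner_add_right]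
      ring
  have hsub : ∀ x : WithLp 2 (F × E), inner ℝ x.fst (S x.snd) - inner ℝ x.fst (T x.snd) =
      ∑ j, σ j * (inner ℝ (u j) x.fst * inner ℝ (v j) x.snd) := by
    intro x
    rw [← inner_sub_right, ← LinearMap.sub_apply, hX, inner_sum]
    refine Finset.sum_congr rfl fun j _ => ?_
    rw [inner_smul_right, real_inner_comm (u j) x.fst]
    ring
  have hDS : ∀ x, 2 * inner ℝ x.fst (S x.snd) ≤ inner ℝ x (D x) := by
    intro x
    have : 0 ≤ ∑ j, σ j / 2 * (inner ℝ (u j) x.fst ^ 2 + inner ℝ (v j) x.snd ^ 2) -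
        ∑ j, σ j * (inner ℝ (u j) x.fst * inner ℝ (v j) x.snd) := by
      rw [← Finset.sum_sub_distrib]
      refine Finset.sum_nonneg fun j _ => ?_
      have := mul_nonneg (hσ0 j)
        (sq_nonneg (inner ℝ (u j) x.fst - inner ℝ (v j) x.snd))
      linarith
    linarith [hform x, hsub x]
  have hDT : ∀ x, 2 * inner ℝ x.fst (T x.snd) ≤ inner ℝ x (D x) := by
    intro x
    have : 0 ≤ ∑ j, σ j / 2 * (inner ℝ (u j) x.fst ^ 2 + inner ℝ (v j) x.snd ^ 2) +
        ∑ j, σ j * (inner ℝ (u j) x.fst * inner ℝ (v j) x.snd) := by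
      rw [← Finset.sum_add_distrib]
      refine Finset.sum_nonneg fun j _ => ?_
      have := mul_nonneg (hσ0 j)
        (sq_nonneg (inner ℝ (u j) x.fst + inner ℝ (v j) x.snd))
      linarith
    linarith [hform x, hsub x]
  obtain ⟨lam, hsum, hlam⟩ := exists_eigenvalue_sequence
    (blockOperator_isSymmetric hP hQ ((1 / 2 : ℝ) • (S + T)))
  rw [trace_blockOperator, htrP, htrQ, finrank_withLp_prod] at hsum
  rw [finrank_withLp_prod] at hlam
  set K := min (finrank ℝ F) (finrank ℝ E) with hK
  have hKr : finrank ℝ (S - T).range ≤ K :=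
    le_min (Submodule.finrank_le _) (S - T).finrank_range_le
  simp_rw [sum_range_singularValues _ hKr, hσ]
  have hmid : ∀ i < finrank ℝ F + finrank ℝ E - K, 0 ≤ lam i := by
    intro i hi
    obtain ⟨W, hW, hWle⟩ := exists_submodule_neg_singularValues_le S K
    have h0 : S.singularValues K = 0 := S.singularValues_eq_zero_iff_le_finrank_range.2
      (le_min (Submodule.finrank_le _) S.finrank_range_le)
    exact hlam i (by omega) _ W (by omega) fun x hx => by
      rw [zero_mul]
      have := (hWle x hx).trans (hDS x)
      rwa [h0, neg_zero, zero_mul] at this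
  have hle : ∀ R : E →ₗ[ℝ] F, (∀ x, 2 * inner ℝ x.fst (R x.snd) ≤ inner ℝ x (D x)) →
      ∀ i < K, R.singularValues i ≤ lam i ∧
        -R.singularValues i ≤ lam (finrank ℝ F + finrank ℝ E - 1 - i) := by
    intro R hR i hi
    refine ⟨?_, ?_⟩
    · obtain ⟨W, hW, hWle⟩ := exists_submodule_singularValues_le R (i := i) (by omega)
      exact hlam i (by omega) _ W hW fun x hx => (hWle x hx).trans (hR x)
    · obtain ⟨W, hW, hWle⟩ := exists_submodule_neg_singularValues_le R i
      exact hlam _ (by omega) _ W (by omega) fun x hx => (hWle x hx).trans (hR x)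
  -- The spectrum splits into `K` top values, `M` nonnegative middle ones and `K` bottom ones, the
  -- last paired in reverse with the top.
  obtain ⟨M, hM⟩ : ∃ M, finrank ℝ F + finrank ℝ E = K + M + K :=
    ⟨finrank ℝ F + finrank ℝ E - 2 * K, by omega⟩
  rw [hM] at hle hmid hsum
  rw [Finset.sum_range_add, Finset.sum_range_add,
    ← Finset.sum_range_reflect (fun i => lam (K + M + i)) K] at hsum
  have hM0 : 0 ≤ ∑ i ∈ Finset.range M, lam (K + i) :=
    Finset.sum_nonneg fun i hi => hmid _ (by have := Finset.mem_range.1 hi; omega)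
  have hmain : ∑ i ∈ Finset.range K, |S.singularValues i - T.singularValues i| ≤
      ∑ i ∈ Finset.range K, (lam i + lam (K + M + (K - 1 - i))) := by
    refine Finset.sum_le_sum fun i hi => ?_
    have hi := Finset.mem_range.1 hi
    obtain ⟨h1, h2⟩ := hle S hDS i hi
    obtain ⟨h3, h4⟩ := hle T hDT i hi
    rw [show K + M + K - 1 - i = K + M + (K - 1 - i) by omega] at h2 h4
    exact abs_le.2 ⟨by linarith, by linarith⟩
  rw [Finset.sum_add_distrib] at hmain
  rw [← Finset.sum_div] at hsum
  linarith

/-! ### Truncation of the singular value decomposition -/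

theorem sum_subtype_singularValues (T : E →ₗ[ℝ] F) (p : ℕ → Prop) [DecidablePred p] :
    ∑ j : {j : Fin (finrank ℝ T.range) // p j}, T.singularValues j =
      ∑ i ∈ (Finset.range (finrank ℝ T.range)).filter p, T.singularValues i := by
  rw [Finset.sum_filter, Finset.sum_range, ← Finset.sum_filter]
  exact (Finset.sum_subtype _ (by simp) fun j : Fin (finrank ℝ T.range) =>
    T.singularValues j).symm

/-- The singular value decomposition splits a map into its part of rank at most `s` carrying the
largest singular values and a remainder. -/
theorem exists_truncation (T : E →ₗ[ℝ] F) (s : ℕ) {k : ℕ}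
    (hk : k = min (finrank ℝ F) (finrank ℝ E)) :
    ∃ R Q : E →ₗ[ℝ] F, R - Q = T ∧ finrank ℝ R.range ≤ s ∧
      ∑ i ∈ Finset.range k, R.singularValues i = ∑ i ∈ Finset.range s, T.singularValues i ∧
      ∑ i ∈ Finset.range k, Q.singularValues i = ∑ i ∈ Finset.Ico s k, T.singularValues i := by
  obtain ⟨v, u, hv, hu, hT⟩ := exists_svd T
  have hrank : ∀ R : E →ₗ[ℝ] F, finrank ℝ R.range ≤ k := fun R => by
    rw [hk]
    exact le_min (Submodule.finrank_le _) R.finrank_range_le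
  have hzero : ∀ i, finrank ℝ T.range ≤ i → T.singularValues i = 0 := fun i =>
    T.singularValues_eq_zero_iff_le_finrank_range.2
  let R : E →ₗ[ℝ] F := ∑ j : {j : Fin (finrank ℝ T.range) // (j : ℕ) < s},
    T.singularValues j • (InnerProductSpace.rankOne ℝ (u j) (v j)).toLinearMap
  -- The sign sits in `-u j`, so `R - Q = T` while the coefficients of `Q` stay nonnegative.
  let Q : E →ₗ[ℝ] F := ∑ j : {j : Fin (finrank ℝ T.range) // ¬ (j : ℕ) < s},
    T.singularValues j • (InnerProductSpace.rankOne ℝ (-u j) (v j)).toLinearMap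
  have hR : ∀ x, R x = ∑ j : {j : Fin (finrank ℝ T.range) // (j : ℕ) < s},
      (T.singularValues j * inner ℝ (v j) x) • u j := fun x => by simp [R, smul_smul]
  have hQ : ∀ x, Q x = ∑ j : {j : Fin (finrank ℝ T.range) // ¬ (j : ℕ) < s},
      (T.singularValues j * inner ℝ (v j) x) • -u j := fun x => by simp [Q, smul_smul]
  have hu' : Orthonormal ℝ fun j => -u j := by
    simpa [orthonormal_iff_ite] using orthonormal_iff_ite.1 hu
  refine ⟨R, Q, ?_, ?_, ?_, ?_⟩
  · ext x
    rw [LinearMap.sub_apply, hR, hQ, hT]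
    simp only [smul_neg, Finset.sum_neg_distrib, sub_neg_eq_add]
    exact Fintype.sum_subtype_add_sum_subtype (fun j : Fin (finrank ℝ T.range) => (j : ℕ) < s)
      fun j => (T.singularValues j * inner ℝ (v j) x) • u j
  · have hle : R.range ≤ Submodule.span ℝ
        (Set.range fun j : {j : Fin (finrank ℝ T.range) // (j : ℕ) < s} => u j) := by
      rintro _ ⟨x, rfl⟩
      rw [hR]
      exact Submodule.sum_mem _ fun j _ =>
        Submodule.smul_mem _ _ (Submodule.subset_span ⟨j, rfl⟩)
    exact (Submodule.finrank_mono hle).trans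
      ((finrank_range_le_card _).trans (card_subtype_fin_lt_le _ s))
  · rw [sum_range_singularValues_eq_of_eq_sum
      (c := fun j : {j : Fin (finrank ℝ T.range) // (j : ℕ) < s} => T.singularValues j)
      (fun j => T.singularValues_nonneg j) (hv.comp _ Subtype.val_injective)
      (hu.comp _ Subtype.val_injective) hR (hrank R),
      sum_subtype_singularValues T fun j => j < s]
    refine Finset.sum_subset (fun i hi => ?_) fun i hi hi' => hzero i ?_
    · simp at hi ⊢
      omega
    · simp at hi hi'
      omega
  · rw [sum_range_singularValues_eq_of_eq_sum
      (c := fun j : {j : Fin (finrank ℝ T.range) // ¬ (j : ℕ) < s} => T.singularValues j)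
      (fun j => T.singularValues_nonneg j) (hv.comp _ Subtype.val_injective)
      (hu'.comp _ Subtype.val_injective) hQ (hrank Q),
      sum_subtype_singularValues T fun j => ¬ j < s]
    have := hrank T
    refine Finset.sum_subset (fun i hi => ?_) fun i hi hi' => hzero i ?_
    · simp at hi ⊢
      omega
    · simp at hi hi'
      omega

end InnerProductSpace

/-! ### Transfer to matrices and the recovery criterion -/

theorem rank_eq_finrank_range_toEuclideanLin {n₁ n₂ : ℕ} (Z : Matrix (Fin n₁) (Fin n₂) ℝ) :
    Z.rank = finrank ℝ (Matrix.toEuclideanLin Z).range := by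
  rw [Matrix.toEuclideanLin, Matrix.toLpLin_eq_toLin]
  exact Matrix.rank_eq_finrank_range_toLin _ _ _

theorem sum_abs_singularValue_sub_le {n₁ n₂ : ℕ} (Y Z : Matrix (Fin n₁) (Fin n₂) ℝ) :
    ∑ i ∈ Finset.range (min n₁ n₂), |singularValue Y i - singularValue Z i| ≤
      nuclearNorm (Y - Z) := by
  simpa [nuclearNorm, singularValue] using
    sum_abs_singularValues_sub_le (Matrix.toEuclideanLin Y) (Matrix.toEuclideanLin Z)

theorem singularValue_nonneg {n₁ n₂ : ℕ} (Z : Matrix (Fin n₁) (Fin n₂) ℝ) (i : ℕ) :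
    0 ≤ singularValue Z i :=
  LinearMap.singularValues_nonneg _ i

theorem singularValue_eq_zero_of_rank_le {n₁ n₂ : ℕ} {Z : Matrix (Fin n₁) (Fin n₂) ℝ} {i : ℕ}
    (h : Z.rank ≤ i) : singularValue Z i = 0 :=
  LinearMap.singularValues_eq_zero_iff_le_finrank_range _ |>.2
    (rank_eq_finrank_range_toEuclideanLin Z ▸ h)

theorem nuclearNorm_lt_nuclearNorm_sub {n₁ n₂ s : ℕ} {Y Z : Matrix (Fin n₁) (Fin n₂) ℝ}
    (hY : Y.rank ≤ s)
    (hZ : ∑ i ∈ Finset.range s, singularValue Z i <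
      ∑ i ∈ Finset.Ico s (min n₁ n₂), singularValue Z i) :
    nuclearNorm Y < nuclearNorm (Y - Z) := by
  -- For larger `s` the right side of `hZ` is an empty sum, which cannot exceed a nonnegative one.
  have hs : s ≤ min n₁ n₂ := by
    by_contra! h
    rw [Finset.Ico_eq_empty (by omega), Finset.sum_empty] at hZ
    exact hZ.not_ge (Finset.sum_nonneg fun i _ => singularValue_nonneg Z i)
  have h := sum_abs_singularValue_sub_le Y Z
  have hY0 : ∀ i ∈ Finset.Ico s (min n₁ n₂), singularValue Y i = 0 := fun i hi =>
    singularValue_eq_zero_of_rank_le (hY.trans (Finset.mem_Ico.1 hi).1)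
  have hYnorm : nuclearNorm Y = ∑ i ∈ Finset.range s, singularValue Y i := by
    rw [nuclearNorm, ← Finset.sum_range_add_sum_Ico _ hs, Finset.sum_eq_zero hY0, add_zero]
  rw [← Finset.sum_range_add_sum_Ico _ hs] at h
  have h1 : ∑ i ∈ Finset.range s, (singularValue Y i - singularValue Z i) ≤
      ∑ i ∈ Finset.range s, |singularValue Y i - singularValue Z i| :=
    Finset.sum_le_sum fun i _ => le_abs_self _
  have h2 : ∑ i ∈ Finset.Ico s (min n₁ n₂), singularValue Z i ≤
      ∑ i ∈ Finset.Ico s (min n₁ n₂), |singularValue Y i - singularValue Z i| :=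
    Finset.sum_le_sum fun i hi => by
      rw [hY0 i hi, zero_sub, abs_neg]
      exact le_abs_self _
  rw [Finset.sum_sub_distrib] at h1
  linarith

theorem exists_matrix_truncation {n₁ n₂ : ℕ} (Z : Matrix (Fin n₁) (Fin n₂) ℝ) (s : ℕ) :
    ∃ X Y : Matrix (Fin n₁) (Fin n₂) ℝ, X - Y = Z ∧ X.rank ≤ s ∧
      nuclearNorm X = ∑ i ∈ Finset.range s, singularValue Z i ∧
      nuclearNorm Y = ∑ i ∈ Finset.Ico s (min n₁ n₂), singularValue Z i := by
  obtain ⟨R, Q, h, hr, hR, hQ⟩ := exists_truncation (Matrix.toEuclideanLin Z) s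
    (k := min n₁ n₂) (by simp)
  refine ⟨Matrix.toEuclideanLin.symm R, Matrix.toEuclideanLin.symm Q, ?_, ?_, ?_, ?_⟩
  · rw [← map_sub, h, LinearEquiv.symm_apply_apply]
  · rwa [rank_eq_finrank_range_toEuclideanLin, LinearEquiv.apply_symm_apply]
  · simpa only [nuclearNorm, singularValue, LinearEquiv.apply_symm_apply] using hR
  · simpa only [nuclearNorm, singularValue, LinearEquiv.apply_symm_apply] using hQ

end NuclearRecovery

theorem corollary6p1 (n₁ n₂ m s : ℕ)
    (A : Matrix (Fin n₁) (Fin n₂) ℝ →ₗ[ℝ] EuclideanSpace ℝ (Fin m)) :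
    NuclearRecovery.RecoversAll A (NuclearRecovery.lowRank n₁ n₂ s) ↔
      ∀ Z : Matrix (Fin n₁) (Fin n₂) ℝ, Z ∈ LinearMap.ker A → Z ≠ 0 →
        ∑ i ∈ Finset.range s, NuclearRecovery.singularValue Z i <
          ∑ i ∈ Finset.Ico s (min n₁ n₂), NuclearRecovery.singularValue Z i := by
  constructor
  · intro hrec Z hZ hZ0
    by_contra! hle
    obtain ⟨X, Y, hXY, hX, hXnorm, hYnorm⟩ :=
      NuclearRecovery.exists_matrix_truncation Z s
    have hAY : A Y = A X := by
      rw [eq_comm, ← sub_eq_zero, ← map_sub, hXY]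
      exact hZ
    have hmin := hrec X hX
    have hXmem : X ∈ NuclearRecovery.nuclearMinimizers A (A X) := hmin ▸ Set.mem_singleton X
    have hYmem : Y ∈ NuclearRecovery.nuclearMinimizers A (A X) :=
      ⟨hAY, fun W hW => (hYnorm.trans_le (hle.trans hXnorm.ge)).trans (hXmem.2 W hW)⟩
    rw [hmin, Set.mem_singleton_iff] at hYmem
    exact hZ0 (by rw [← hXY, hYmem, sub_self])
  · intro hnull X hX
    have hlt : ∀ Y, A Y = A X → Y ≠ X →
        NuclearRecovery.nuclearNorm X < NuclearRecovery.nuclearNorm Y := by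
      intro Y hY hne
      -- The competitor is written as `Y = X - (X - Y)`, with `X - Y` in the kernel.
      have h := NuclearRecovery.nuclearNorm_lt_nuclearNorm_sub hX
        (hnull (X - Y) (by simp [hY]) (sub_ne_zero.2 hne.symm))
      rwa [sub_sub_cancel] at h
    refine Set.eq_singleton_iff_unique_mem.2 ⟨⟨rfl, fun Y hY => ?_⟩, fun Y hY => ?_⟩
    · rcases eq_or_ne Y X with rfl | hne
      · exact le_rfl
      · exact (hlt Y hY hne).le
    · by_contra hne
      exact (hlt Y hY.1 hne).not_ge (hY.2 X rfl)
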